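/- Let $d\ge 1$ and let $D\subset\mathbb{R}^d$ be a bounded domain (nonempty, open, connected) with Lipschitz boundary (in particular, any bounded domain with smooth boundary), with surface measure $da$ on $\partial D$. Let $\partial D=\Gamma_1\cup\Gamma_2\cup\Gamma_3$ with $\Gamma_1,\Gamma_2,\Gamma_3$ pairwise disjoint and measurable, and $\mathrm{meas}(\Gamma_1)>0$. Let $V=\{v\in H^1(D): v=0 \text{ on }\Gamma_1\}$ (boundary values in the sense of traces) with the inner product and norm of $H^1(D)$, let $V^*$ be its dual and $\langle\cdot,\cdot\rangle$ the duality pairing. Let $b\in L^2(\Gamma_2)$ be such that there is $u_b\in V$ with $u_b\ge 0$ a.e. in $D$ and $u_b=b$ a.e. on $\Gamma_2$, and put $$K=\{v\in V: v\ge 0 \text{ a.e. in } D,\ v=b \text{ a.e. on }\Gamma_2\}.$$ Let $p_0:D\times\mathbb{R}\to\mathbb{R}$ and $p_2:\Gamma_2\times\mathbb{R}\to\mathbb{R}$ be such that, for some constants $L_0,L_2>0$: $p_0(\cdot,r)$ is measurable on $D$ and $p_2(\cdot,r)$ is measurable on $\Gamma_2$ for every $r\in\mathbb{R}$; and, for a.e.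 $x\in D$ (for $i=0$), respectively a.e. $x\in\Gamma_2$ (for $i=2$), and all $r,s\in\mathbb{R}$, $$|p_i(x,r)-p_i(x,s)|\le L_i|r-s|,\qquad (p_i(x,r)-p_i(x,s))(r-s)\ge 0,$$ $$p_0(x,r)=0\iff r\ge 0,\qquad p_2(x,r)=0\iff r=0.$$ Then for all $u,v\in V$ the functions $p_0(\cdot,u)v$ and $p_2(\cdot,u-b)v$ are integrable on $D$ and on $\Gamma_2$, respectively, and $$\langle Gu,v\rangle=\int_D p_0(x,u)\,v\,dx+\int_{\Gamma_2}p_2(x,u-b)\,v\,da\qquad\forall\,u,v\in V$$ defines an operator $G:V\to V^*$. Moreover, with $\widetilde K=V$: 1. $\widetilde K$ is a closed convex subset of $V$ and $K\subset\widetilde K$. 2. (a) $G$ is bounded (it maps bounded sets to bounded sets), demicontinuous ($u_n\to u$ in $V$ implies $Gu_n\rightharpoonup Gu$ weakly in $V^*$) and monotone ($\langle Gu-Gv,u-v\rangle\ge 0$ for all $u,v\in V$); (b) $\langle Gu,v-u\rangle\le 0$ for all $u\in\widetilde K$, $v\in K$; (c) if $u\in\widetilde K$ and $\langle Gu,v-u\rangle=0$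 for all $v\in K$, then $u\in K$. -/

import Mathlib

open MeasureTheory Filter Topology
open scoped ENNReal NNReal ContDiff

noncomputable section

/-! ### Operators from a normed space to its dual, and the abstract penalty conditions -/

section Operators

variable {X : Type*} [NormedAddCommGroup X] [NormedSpace ℝ X]

/-- `A : X → X*` is monotone. -/
def IsMonotoneOp (A : X → StrongDual ℝ X) : Prop :=
  ∀ u v : X, 0 ≤ (A u - A v) (u - v)

/-- `A : X → X*` maps bounded sets to bounded sets. -/
def IsBoundedOp (A : X → StrongDual ℝ X) : Prop :=
  ∀ S : Set X, Bornology.IsBounded S → Bornology.IsBounded (A '' S)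

/-- `A : X → X*` is demicontinuous: `u n → u` in `X` implies `A (u n) ⇀ A u` weakly in `X*`
(that is, when tested against every element of the bidual of `X`). -/
def IsDemicontinuousOp (A : X → StrongDual ℝ X) : Prop :=
  ∀ (u : ℕ → X) (u₀ : X), Tendsto u atTop (𝓝 u₀) →
    ∀ ξ : StrongDual ℝ (StrongDual ℝ X), Tendsto (fun n => ξ (A (u n))) atTop (𝓝 (ξ (A u₀)))

/-- The condition on the relaxed constraint set `Kt`, relative to the constraint set `K`. -/
structure RelaxedSetCondition (K Kt : Set X) : Prop where
  isClosed : IsClosed Kt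
  convex : Convex ℝ Kt
  subset : K ⊆ Kt

/-- The condition on the penalty operator `G`, relative to `K` and to `Kt`. -/
structure PenaltyOperatorCondition (K Kt : Set X) (G : X → StrongDual ℝ X) : Prop where
  bounded : IsBoundedOp G
  demicontinuous : IsDemicontinuousOp G
  monotone : IsMonotoneOp G
  nonpos : ∀ u ∈ Kt, ∀ v ∈ K, G u (v - u) ≤ 0
  mem_of_eq_zero : ∀ u ∈ Kt, (∀ v ∈ K, G u (v - u) = 0) → u ∈ K

end Operators

/-! ### The domain and its boundary -/

section Domain

variable {n : ℕ}

/-- A bounded domain of `ℝⁿ⁺¹` with Lipschitz boundary: near each boundary point, after an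
orthogonal change of coordinates, the domain is the part of space lying strictly above the graph
of a Lipschitz function of the last `n` coordinates. -/
structure IsLipschitzDomain (D : Set (EuclideanSpace ℝ (Fin (n + 1)))) : Prop where
  isOpen : IsOpen D
  isConnected : IsConnected D
  isBounded : Bornology.IsBounded D
  exists_graph : ∀ x₀ ∈ frontier D,
    ∃ (e : EuclideanSpace ℝ (Fin (n + 1)) ≃ₗᵢ[ℝ] EuclideanSpace ℝ (Fin (n + 1)))
      (h : EuclideanSpace ℝ (Fin n) → ℝ) (L : ℝ≥0) (U : Set (EuclideanSpace ℝ (Fin (n + 1)))),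
      LipschitzWith L h ∧ IsOpen U ∧ x₀ ∈ U ∧
        ∀ x ∈ U, x ∈ D ↔ h (WithLp.toLp 2 fun i : Fin n => e x i.succ) < e x 0

/-- The surface measure on the boundary of `D`: the `n`-dimensional Hausdorff measure, with the
Euclidean normalization, restricted to the topological boundary. -/
def surfaceMeasure (D : Set (EuclideanSpace ℝ (Fin (n + 1)))) :
    Measure (EuclideanSpace ℝ (Fin (n + 1))) :=
  (Measure.euclideanHausdorffMeasure n).restrict (frontier D)

/-- `∂D` is the union of the pairwise disjoint measurable parts `Γ₁`, `Γ₂`, `Γ₃`, and `Γ₁` has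
positive surface measure. -/
structure IsBoundaryPartition (D Γ₁ Γ₂ Γ₃ : Set (EuclideanSpace ℝ (Fin (n + 1)))) : Prop where
  union_eq : Γ₁ ∪ Γ₂ ∪ Γ₃ = frontier D
  measurable₁ : NullMeasurableSet Γ₁ (surfaceMeasure D)
  measurable₂ : NullMeasurableSet Γ₂ (surfaceMeasure D)
  measurable₃ : NullMeasurableSet Γ₃ (surfaceMeasure D)
  disjoint₁₂ : Disjoint Γ₁ Γ₂
  disjoint₁₃ : Disjoint Γ₁ Γ₃
  disjoint₂₃ : Disjoint Γ₂ Γ₃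
  meas_pos : 0 < surfaceMeasure D Γ₁

end Domain

/-! ### The Sobolev space `H¹(D)`, traces, and the space `V` -/

section Sobolev

variable {n : ℕ}

/-- The Hilbert space `L²(D) × L²(D)ⁿ⁺¹`. -/
abbrev L2Pair (D : Set (EuclideanSpace ℝ (Fin (n + 1)))) : Type :=
  WithLp 2 (Lp ℝ 2 (volume.restrict D) ×
    Lp (EuclideanSpace ℝ (Fin (n + 1))) 2 (volume.restrict D))

/-- `g ∈ L²(D)ⁿ⁺¹` is the weak gradient of `u ∈ L²(D)`. -/
def IsWeakGradient (D : Set (EuclideanSpace ℝ (Fin (n + 1))))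
    (u : Lp ℝ 2 (volume.restrict D))
    (g : Lp (EuclideanSpace ℝ (Fin (n + 1))) 2 (volume.restrict D)) : Prop :=
  ∀ φ : EuclideanSpace ℝ (Fin (n + 1)) → ℝ,
    ContDiff ℝ ∞ φ → HasCompactSupport φ → tsupport φ ⊆ D → ∀ i : Fin (n + 1),
      ∫ x in D, u x * fderiv ℝ φ x (EuclideanSpace.single i 1) = - ∫ x in D, g x i * φ x

lemma integrable_mul_test {μ : Measure (EuclideanSpace ℝ (Fin (n + 1)))}
    [IsFiniteMeasureOnCompacts μ] (u : Lp ℝ 2 μ) {ψ : EuclideanSpace ℝ (Fin (n + 1)) → ℝ}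
    (hc : Continuous ψ) (hs : HasCompactSupport ψ) : Integrable (fun x => u x * ψ x) μ :=
  (Lp.memLp u).integrable_mul (q := 2) (hc.memLp_of_hasCompactSupport hs)

lemma integrable_coord_mul_test {μ : Measure (EuclideanSpace ℝ (Fin (n + 1)))}
    [IsFiniteMeasureOnCompacts μ] (g : Lp (EuclideanSpace ℝ (Fin (n + 1))) 2 μ)
    (i : Fin (n + 1)) {ψ : EuclideanSpace ℝ (Fin (n + 1)) → ℝ}
    (hc : Continuous ψ) (hs : HasCompactSupport ψ) : Integrable (fun x => g x i * ψ x) μ := by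
  have h : MemLp (fun x => g x i) 2 μ :=
    ((EuclideanSpace.proj i : EuclideanSpace ℝ (Fin (n + 1)) →L[ℝ] ℝ)).comp_memLp' (Lp.memLp g)
  exact h.integrable_mul (q := 2) (hc.memLp_of_hasCompactSupport hs)

/-- The Sobolev space `H¹(D)`: the pairs `(u, ∇u)` of a function in `L²(D)` and its weak gradient
in `L²(D)ⁿ⁺¹`. As a subspace of the Hilbert space `L²(D) × L²(D)ⁿ⁺¹` it carries the usual inner
product `(u, v)_{L²} + (∇u, ∇v)_{L²}` of `H¹(D)`. -/
def H1 (D : Set (EuclideanSpace ℝ (Fin (n + 1)))) :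
    Submodule ℝ (L2Pair D) where
  carrier := {w | IsWeakGradient D w.fst w.snd}
  zero_mem' := by
    intro φ hφ hs hD i
    have h1 : ∫ x in D, (0 : Lp ℝ 2 (volume.restrict D)) x *
        fderiv ℝ φ x (EuclideanSpace.single i 1) = 0 := by
      refine integral_eq_zero_of_ae ?_
      filter_upwards [Lp.coeFn_zero ℝ 2 (volume.restrict D)] with x hx
      rw [hx]; simp
    have h2 : ∫ x in D, (0 : Lp (EuclideanSpace ℝ (Fin (n + 1))) 2 (volume.restrict D)) x i *
        φ x = 0 := by
      refine integral_eq_zero_of_ae ?_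
      filter_upwards [Lp.coeFn_zero (EuclideanSpace ℝ (Fin (n + 1))) 2 (volume.restrict D)]
        with x hx
      rw [hx]; simp
    change ∫ x in D, (0 : Lp ℝ 2 (volume.restrict D)) x *
        fderiv ℝ φ x (EuclideanSpace.single i 1) =
      - ∫ x in D, (0 : Lp (EuclideanSpace ℝ (Fin (n + 1))) 2 (volume.restrict D)) x i * φ x
    rw [h1, h2, neg_zero]
  add_mem' := by
    intro w z hw hz φ hφ hs hD i
    have hc : Continuous fun x => fderiv ℝ φ x (EuclideanSpace.single i 1) :=
      (hφ.continuous_fderiv (by simp)).clm_apply continuous_const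
    have hcs : HasCompactSupport fun x => fderiv ℝ φ x (EuclideanSpace.single i 1) :=
      hs.fderiv_apply (𝕜 := ℝ) _
    have h1 : ∫ x in D, (w.fst + z.fst : Lp ℝ 2 (volume.restrict D)) x *
        fderiv ℝ φ x (EuclideanSpace.single i 1) =
        ∫ x in D, (w.fst x * fderiv ℝ φ x (EuclideanSpace.single i 1) +
          z.fst x * fderiv ℝ φ x (EuclideanSpace.single i 1)) := by
      refine integral_congr_ae ?_
      filter_upwards [Lp.coeFn_add w.fst z.fst] with x hx
      rw [hx]; simp [add_mul]
    have h2 : ∫ x in D, (w.snd + z.snd :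
        Lp (EuclideanSpace ℝ (Fin (n + 1))) 2 (volume.restrict D)) x i * φ x =
        ∫ x in D, (w.snd x i * φ x + z.snd x i * φ x) := by
      refine integral_congr_ae ?_
      filter_upwards [Lp.coeFn_add w.snd z.snd] with x hx
      rw [hx]; simp [add_mul]
    change ∫ x in D, (w.fst + z.fst : Lp ℝ 2 (volume.restrict D)) x *
        fderiv ℝ φ x (EuclideanSpace.single i 1) =
      - ∫ x in D, (w.snd + z.snd :
        Lp (EuclideanSpace ℝ (Fin (n + 1))) 2 (volume.restrict D)) x i * φ x
    rw [h1, h2, integral_add (integrable_mul_test _ hc hcs) (integrable_mul_test _ hc hcs),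
      integral_add (integrable_coord_mul_test _ i hφ.continuous hs)
        (integrable_coord_mul_test _ i hφ.continuous hs), hw φ hφ hs hD i, hz φ hφ hs hD i]
    ring
  smul_mem' := by
    intro c w hw φ hφ hs hD i
    have h1 : ∫ x in D, (c • w.fst : Lp ℝ 2 (volume.restrict D)) x *
        fderiv ℝ φ x (EuclideanSpace.single i 1) =
        ∫ x in D, c * (w.fst x * fderiv ℝ φ x (EuclideanSpace.single i 1)) := by
      refine integral_congr_ae ?_
      filter_upwards [Lp.coeFn_smul c w.fst] with x hx
      rw [hx]; simp [mul_assoc]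
    have h2 : ∫ x in D, (c • w.snd :
        Lp (EuclideanSpace ℝ (Fin (n + 1))) 2 (volume.restrict D)) x i * φ x =
        ∫ x in D, c * (w.snd x i * φ x) := by
      refine integral_congr_ae ?_
      filter_upwards [Lp.coeFn_smul c w.snd] with x hx
      rw [hx]; simp [mul_assoc]
    change ∫ x in D, (c • w.fst : Lp ℝ 2 (volume.restrict D)) x *
        fderiv ℝ φ x (EuclideanSpace.single i 1) =
      - ∫ x in D, (c • w.snd :
        Lp (EuclideanSpace ℝ (Fin (n + 1))) 2 (volume.restrict D)) x i * φ x
    rw [h1, h2, integral_const_mul, integral_const_mul, hw φ hφ hs hD i]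
    ring

/-- `g ∈ L²(∂D)` is the trace of `u ∈ H¹(D)`: there are functions `φ k`, smooth up to the boundary,
with `φ k → u` in `H¹(D)` and `φ k → g` in `L²(∂D)`. -/
def HasTrace {D : Set (EuclideanSpace ℝ (Fin (n + 1)))} (u : H1 D)
    (g : Lp ℝ 2 (surfaceMeasure D)) : Prop :=
  ∃ φ : ℕ → EuclideanSpace ℝ (Fin (n + 1)) → ℝ,
    (∀ k, ContDiff ℝ ∞ (φ k)) ∧
    Tendsto (fun k => eLpNorm (fun x => φ k x - u.1.fst x) 2 (volume.restrict D)) atTop (𝓝 0) ∧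
    Tendsto (fun k => eLpNorm (fun x => gradient (φ k) x - u.1.snd x) 2 (volume.restrict D))
      atTop (𝓝 0) ∧
    Tendsto (fun k => eLpNorm (fun x => φ k x - g x) 2 (surfaceMeasure D)) atTop (𝓝 0)

/-- Passing to the limit in `L²`-seminorms of sums. -/
lemma tendsto_eLpNorm_add {α F : Type*} [MeasurableSpace α] [NormedAddCommGroup F]
    {μ : Measure α} {f g : ℕ → α → F}
    (hfm : ∀ k, AEStronglyMeasurable (f k) μ) (hgm : ∀ k, AEStronglyMeasurable (g k) μ)
    (hf : Tendsto (fun k => eLpNorm (f k) 2 μ) atTop (𝓝 0))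
    (hg : Tendsto (fun k => eLpNorm (g k) 2 μ) atTop (𝓝 0)) :
    Tendsto (fun k => eLpNorm (f k + g k) 2 μ) atTop (𝓝 0) := by
  have h := hf.add hg
  rw [add_zero] at h
  exact tendsto_of_tendsto_of_tendsto_of_le_of_le tendsto_const_nhds h (fun _ => zero_le)
    (fun k => eLpNorm_add_le (hfm k) (hgm k) (by norm_num))

lemma tendsto_eLpNorm_smul {α F : Type*} [MeasurableSpace α] [NormedAddCommGroup F]
    [NormedSpace ℝ F] {μ : Measure α} {f : ℕ → α → F} (c : ℝ)
    (hf : Tendsto (fun k => eLpNorm (f k) 2 μ) atTop (𝓝 0)) :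
    Tendsto (fun k => eLpNorm (c • f k) 2 μ) atTop (𝓝 0) := by
  have h := ENNReal.Tendsto.const_mul (a := ‖c‖ₑ) hf (Or.inr (by simp))
  rw [mul_zero] at h
  simpa only [eLpNorm_const_smul] using h

lemma HasTrace.zero {D : Set (EuclideanSpace ℝ (Fin (n + 1)))} :
    HasTrace (0 : H1 D) 0 := by
  refine ⟨fun _ _ => 0, fun _ => contDiff_const, ?_, ?_, ?_⟩
  · refine tendsto_const_nhds.congr fun k => Eq.symm ?_
    rw [eLpNorm_congr_ae (g := fun _ => (0 : ℝ))]
    · simp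
    · filter_upwards [Lp.coeFn_zero ℝ 2 (volume.restrict D)] with x hx
      change 0 - (0 : Lp ℝ 2 (volume.restrict D)) x = 0
      rw [hx]; simp
  · refine tendsto_const_nhds.congr fun k => Eq.symm ?_
    rw [eLpNorm_congr_ae (g := fun _ => (0 : EuclideanSpace ℝ (Fin (n + 1))))]
    · simp
    · filter_upwards [Lp.coeFn_zero (EuclideanSpace ℝ (Fin (n + 1))) 2 (volume.restrict D)]
        with x hx
      change gradient (fun _ => (0 : ℝ)) x -
        (0 : Lp (EuclideanSpace ℝ (Fin (n + 1))) 2 (volume.restrict D)) x = 0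
      rw [hx]; simp [gradient]
  · refine tendsto_const_nhds.congr fun k => Eq.symm ?_
    rw [eLpNorm_congr_ae (g := fun _ => (0 : ℝ))]
    · simp
    · filter_upwards [Lp.coeFn_zero ℝ 2 (surfaceMeasure D)] with x hx
      rw [hx]; simp

lemma continuous_gradient_of_smooth {φ : EuclideanSpace ℝ (Fin (n + 1)) → ℝ}
    (hφ : ContDiff ℝ ∞ φ) : Continuous (gradient φ) :=
  (InnerProductSpace.toDual ℝ (EuclideanSpace ℝ (Fin (n + 1)))).symm.continuous.comp
    (hφ.continuous_fderiv (by simp))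

lemma HasTrace.add {D : Set (EuclideanSpace ℝ (Fin (n + 1)))} {u v : H1 D}
    {g h : Lp ℝ 2 (surfaceMeasure D)} (hu : HasTrace u g) (hv : HasTrace v h) :
    HasTrace (u + v) (g + h) := by
  obtain ⟨φ, hφ, h1, h2, h3⟩ := hu
  obtain ⟨ψ, hψ, k1, k2, k3⟩ := hv
  refine ⟨fun k x => φ k x + ψ k x, fun k => (hφ k).add (hψ k), ?_, ?_, ?_⟩
  · refine (tendsto_eLpNorm_add (fun k => ?_) (fun k => ?_) h1 k1).congr fun k =>
      eLpNorm_congr_ae ?_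
    · exact (hφ k).continuous.aestronglyMeasurable.sub (Lp.aestronglyMeasurable _)
    · exact (hψ k).continuous.aestronglyMeasurable.sub (Lp.aestronglyMeasurable _)
    · filter_upwards [Lp.coeFn_add u.1.fst v.1.fst] with x hx
      change (φ k x - u.1.fst x) + (ψ k x - v.1.fst x) =
        φ k x + ψ k x - (u.1.fst + v.1.fst : Lp ℝ 2 (volume.restrict D)) x
      rw [hx, Pi.add_apply]; ring
  · refine (tendsto_eLpNorm_add (fun k => ?_) (fun k => ?_) h2 k2).congr fun k =>
      eLpNorm_congr_ae ?_
    · exact (continuous_gradient_of_smooth (hφ k)).aestronglyMeasurable.sub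
        (Lp.aestronglyMeasurable _)
    · exact (continuous_gradient_of_smooth (hψ k)).aestronglyMeasurable.sub
        (Lp.aestronglyMeasurable _)
    · filter_upwards [Lp.coeFn_add u.1.snd v.1.snd] with x hx
      change (gradient (φ k) x - u.1.snd x) + (gradient (ψ k) x - v.1.snd x) =
        gradient (fun x => φ k x + ψ k x) x - (u.1.snd + v.1.snd :
          Lp (EuclideanSpace ℝ (Fin (n + 1))) 2 (volume.restrict D)) x
      have hd : gradient (fun x => φ k x + ψ k x) x = gradient (φ k) x + gradient (ψ k) x := by
        unfold gradient
        rw [fderiv_fun_add ((hφ k).differentiable (by simp) x)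
          ((hψ k).differentiable (by simp) x), map_add]
      rw [hx, Pi.add_apply, hd]; abel
  · refine (tendsto_eLpNorm_add (fun k => ?_) (fun k => ?_) h3 k3).congr fun k =>
      eLpNorm_congr_ae ?_
    · exact (hφ k).continuous.aestronglyMeasurable.sub (Lp.aestronglyMeasurable _)
    · exact (hψ k).continuous.aestronglyMeasurable.sub (Lp.aestronglyMeasurable _)
    · filter_upwards [Lp.coeFn_add g h] with x hx
      change (φ k x - g x) + (ψ k x - h x) = φ k x + ψ k x - (g + h : Lp ℝ 2 _) x
      rw [hx, Pi.add_apply]; ring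

lemma HasTrace.smul {D : Set (EuclideanSpace ℝ (Fin (n + 1)))} {u : H1 D}
    {g : Lp ℝ 2 (surfaceMeasure D)} (c : ℝ) (hu : HasTrace u g) :
    HasTrace (c • u) (c • g) := by
  obtain ⟨φ, hφ, h1, h2, h3⟩ := hu
  refine ⟨fun k x => c * φ k x, fun k => contDiff_const.mul (hφ k), ?_, ?_, ?_⟩
  · refine (tendsto_eLpNorm_smul c h1).congr fun k => eLpNorm_congr_ae ?_
    filter_upwards [Lp.coeFn_smul c u.1.fst] with x hx
    change c * (φ k x - u.1.fst x) = c * φ k x - (c • u.1.fst : Lp ℝ 2 (volume.restrict D)) x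
    rw [hx, Pi.smul_apply, smul_eq_mul]; ring
  · refine (tendsto_eLpNorm_smul c h2).congr fun k => eLpNorm_congr_ae ?_
    filter_upwards [Lp.coeFn_smul c u.1.snd] with x hx
    change c • (gradient (φ k) x - u.1.snd x) = gradient (fun x => c * φ k x) x -
      (c • u.1.snd : Lp (EuclideanSpace ℝ (Fin (n + 1))) 2 (volume.restrict D)) x
    have hd : gradient (fun x => c * φ k x) x = c • gradient (φ k) x := by
      unfold gradient
      rw [fderiv_const_mul ((hφ k).differentiable (by simp) x), map_smul]
    rw [hx, Pi.smul_apply, hd, smul_sub]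
  · refine (tendsto_eLpNorm_smul c h3).congr fun k => eLpNorm_congr_ae ?_
    filter_upwards [Lp.coeFn_smul c g] with x hx
    change c * (φ k x - g x) = c * φ k x - (c • g : Lp ℝ 2 _) x
    rw [hx, Pi.smul_apply, smul_eq_mul]; ring

/-- The subspace of the functions in `H¹(D)` whose trace vanishes almost everywhere on `Γ₁`.
(On a bounded Lipschitz domain every function in `H¹(D)` has exactly one trace in `L²(∂D)`.) -/
def zeroTraceSubmodule (D Γ₁ : Set (EuclideanSpace ℝ (Fin (n + 1)))) : Submodule ℝ (H1 D) where
  carrier := {u | ∃ g, HasTrace u g ∧ ∀ᵐ x ∂(surfaceMeasure D).restrict Γ₁, g x = 0}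
  zero_mem' := by
    refine ⟨0, HasTrace.zero, ae_restrict_of_ae ?_⟩
    filter_upwards [Lp.coeFn_zero ℝ 2 (surfaceMeasure D)] with x hx
    rw [hx]; simp
  add_mem' := by
    rintro u v ⟨g, hg, hg0⟩ ⟨h, hh, hh0⟩
    refine ⟨g + h, hg.add hh, ?_⟩
    filter_upwards [hg0, hh0, ae_restrict_of_ae (Lp.coeFn_add g h)] with x h1 h2 h3
    rw [h3]; simp [h1, h2]
  smul_mem' := by
    rintro c u ⟨g, hg, hg0⟩
    refine ⟨c • g, hg.smul c, ?_⟩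
    filter_upwards [hg0, ae_restrict_of_ae (Lp.coeFn_smul c g)] with x h1 h2
    rw [h2]; simp [h1]

/-- The space `V = {v ∈ H¹(D) : v = 0 on Γ₁}`, with the inner product and norm of `H¹(D)`. -/
def V (D Γ₁ : Set (EuclideanSpace ℝ (Fin (n + 1)))) : Type := zeroTraceSubmodule D Γ₁

instance (D Γ₁ : Set (EuclideanSpace ℝ (Fin (n + 1)))) : NormedAddCommGroup (V D Γ₁) :=
  inferInstanceAs (NormedAddCommGroup (zeroTraceSubmodule D Γ₁))

instance (D Γ₁ : Set (EuclideanSpace ℝ (Fin (n + 1)))) : InnerProductSpace ℝ (V D Γ₁) :=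
  inferInstanceAs (InnerProductSpace ℝ (zeroTraceSubmodule D Γ₁))

variable {D Γ₁ : Set (EuclideanSpace ℝ (Fin (n + 1)))}

/-- The function on `D` underlying an element of `V`. -/
def interiorFun (v : V D Γ₁) : EuclideanSpace ℝ (Fin (n + 1)) → ℝ := v.1.1.fst

/-- The trace on `∂D` of an element of `V`. -/
def boundaryTrace (v : V D Γ₁) : Lp ℝ 2 (surfaceMeasure D) := v.2.choose

lemma hasTrace_boundaryTrace (v : V D Γ₁) : HasTrace v.1 (boundaryTrace v) :=
  v.2.choose_spec.1

end Sobolev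

/-! ### The obstacle set and the penalty functions -/

section Penalty

variable {n : ℕ}

/-- `v ≥ 0` in `D`. -/
def NonnegInside {D Γ₁ : Set (EuclideanSpace ℝ (Fin (n + 1)))} (v : V D Γ₁) : Prop :=
  ∀ᵐ x ∂volume.restrict D, 0 ≤ interiorFun v x

/-- `v = b` on `Γ₂`, in the sense of traces. -/
def EqOnBoundaryPart {D Γ₁ : Set (EuclideanSpace ℝ (Fin (n + 1)))}
    (Γ₂ : Set (EuclideanSpace ℝ (Fin (n + 1)))) (b : EuclideanSpace ℝ (Fin (n + 1)) → ℝ)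
    (v : V D Γ₁) : Prop :=
  ∀ᵐ x ∂(surfaceMeasure D).restrict Γ₂, boundaryTrace v x = b x

/-- The set `K` of the `v ∈ V` with `v ≥ 0` in `D` and `v = b` on `Γ₂`. -/
def obstacleSet (D Γ₁ Γ₂ : Set (EuclideanSpace ℝ (Fin (n + 1))))
    (b : EuclideanSpace ℝ (Fin (n + 1)) → ℝ) : Set (V D Γ₁) :=
  {v | NonnegInside v ∧ EqOnBoundaryPart Γ₂ b v}

/-- `p` is, `μ`-almost everywhere in its first variable, Lipschitz (with a uniform constant) and
monotone in its second variable, with zero set exactly `Z`; it is measurable in its first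
variable. -/
structure IsPenaltyFunction {α : Type*} [MeasurableSpace α] (μ : Measure α) (Z : Set ℝ)
    (p : α → ℝ → ℝ) : Prop where
  lipschitz : ∃ L : ℝ, 0 < L ∧ ∀ᵐ x ∂μ, ∀ r s : ℝ, |p x r - p x s| ≤ L * |r - s|
  monotone : ∀ᵐ x ∂μ, ∀ r s : ℝ, 0 ≤ (p x r - p x s) * (r - s)
  measurable : ∀ r : ℝ, AEMeasurable (fun x => p x r) μ
  eq_zero_iff : ∀ᵐ x ∂μ, ∀ r : ℝ, p x r = 0 ↔ r ∈ Z

end Penalty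

end

noncomputable section

/-! ### The trace inequality -/

section TraceInequality

variable {n : ℕ}

/-! On each of `D` and `Γ₂`, `G` has the form `T* ∘ N ∘ T`: `T` is a continuous linear map of `V`
into an `L²` space (the embedding into `L²(D)`; the trace on `Γ₂`, shifted by `b` before `N` acts)
and `N` is the superposition operator `f ↦ p(·, f)`. Since `p(x, 0) = 0` and `p(x, ·)` is uniformly
Lipschitz, `N` is Lipschitz on `L²`. So `G` is Lipschitz in norm
(`exists_lipschitzWith_penaltyOperator`), which gives boundedness and demicontinuity together.
Monotonicity is pointwise.

For `v ∈ K` both integrands of `⟨Gu, v - u⟩` are nonpositive almost everywhere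
(`interior_penalty_nonpos`, `boundary_penalty_nonpos`). If the pairing vanishes for a single such
`v`, then both integrands vanish almost everywhere, so at almost every point either the penalty is
zero or `u = v`; either way `u` satisfies the constraint there.

The analytic input is continuity of the trace. As `boundaryTrace` is selected by choice, even its
linearity requires uniqueness of traces. Both follow from the trace inequality for smooth functions
(`exists_lintegral_trace_le`): in a graph chart, the value at a boundary point is controlled by an
integral over a short vertical segment inside `D`; Fubini and compactness of the boundary finish the
argument. -/

lemma euclideanHausdorffMeasure_image_le {X Y : Type*} [EMetricSpace X] [EMetricSpace Y]
    [MeasurableSpace X] [BorelSpace X] [MeasurableSpace Y] [BorelSpace Y] {K : ℝ≥0} {f : X → Y}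
    (hf : LipschitzWith K f) (d : ℕ) (s : Set X) :
    Measure.euclideanHausdorffMeasure d (f '' s) ≤
      (K : ℝ≥0∞) ^ d * Measure.euclideanHausdorffMeasure d s := by
  simp only [Measure.euclideanHausdorffMeasure_def, Measure.smul_apply, ENNReal.smul_def,
    smul_eq_mul]
  have h := hf.hausdorffMeasure_image_le (d := d) (by positivity) s
  rw [ENNReal.rpow_natCast] at h
  rw [mul_left_comm]
  gcongr

/-- Only the easy half of the area formula is needed. A part of `S` is the image of its own preimage
under `γ`, so the Lipschitz bound for images dominates Hausdorff measure on `S` by a multiple of the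
push-forward of Lebesgue measure. -/
lemma setLIntegral_euclideanHausdorffMeasure_le {Y : Type*} [EMetricSpace Y] [MeasurableSpace Y]
    [BorelSpace Y] {K : ℝ≥0} {γ : EuclideanSpace ℝ (Fin n) → Y} (hγ : LipschitzWith K γ)
    {S : Set Y} (hSγ : S ⊆ Set.range γ) {f : Y → ℝ≥0∞}
    (hf : Measurable f) :
    ∫⁻ x in S, f x ∂(Measure.euclideanHausdorffMeasure n) ≤
      (K : ℝ≥0∞) ^ n * ∫⁻ y in γ ⁻¹' S, f (γ y) := by
  have hm : Measurable γ := hγ.continuous.measurable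
  have hle : (Measure.euclideanHausdorffMeasure n).restrict S ≤
      (K : ℝ≥0∞) ^ n • (volume.restrict (γ ⁻¹' S)).map γ := by
    refine Measure.le_iff.2 fun A hA => ?_
    rw [Measure.restrict_apply hA, Measure.smul_apply, Measure.map_apply hm hA,
      Measure.restrict_apply (hm hA), smul_eq_mul, ← Set.preimage_inter,
      ← EuclideanSpace.euclideanHausdorffMeasure_eq_volume]
    conv_lhs => rw [← Set.image_preimage_eq_of_subset (Set.inter_subset_right.trans hSγ)]
    exact euclideanHausdorffMeasure_image_le hγ n _
  calc _ ≤ ∫⁻ x, f x ∂((K : ℝ≥0∞) ^ n • (volume.restrict (γ ⁻¹' S)).map γ) :=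
        lintegral_mono' hle le_rfl
    _ = _ := by rw [lintegral_smul_measure, lintegral_map hf hm, smul_eq_mul]

/-- The point with first coordinate `t` and remaining coordinates `y`. -/
def consPoint (y : EuclideanSpace ℝ (Fin n)) (t : ℝ) : EuclideanSpace ℝ (Fin (n + 1)) :=
  WithLp.toLp 2 (Fin.cons t fun i => y i)

@[simp] lemma consPoint_zero (y : EuclideanSpace ℝ (Fin n)) (t : ℝ) : consPoint y t 0 = t := rfl

@[simp] lemma consPoint_succ (y : EuclideanSpace ℝ (Fin n)) (t : ℝ) (i : Fin n) :
    consPoint y t i.succ = y i := rfl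

lemma consPoint_self (x : EuclideanSpace ℝ (Fin (n + 1))) :
    consPoint (WithLp.toLp 2 fun i : Fin n => x i.succ) (x 0) = x := by
  ext i
  refine Fin.cases ?_ (fun j => ?_) i <;> simp

lemma consPoint_add (y : EuclideanSpace ℝ (Fin n)) (t s : ℝ) :
    consPoint y (t + s) = consPoint y t + s • EuclideanSpace.single 0 1 := by
  ext i
  refine Fin.cases ?_ (fun j => ?_) i <;> simp

lemma dist_consPoint_le (y z : EuclideanSpace ℝ (Fin n)) (t s : ℝ) :
    dist (consPoint y t) (consPoint z s) ≤ dist y z + dist t s := by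
  rw [EuclideanSpace.dist_eq, EuclideanSpace.dist_eq, Fin.sum_univ_succ]
  simp only [consPoint_zero, consPoint_succ]
  refine Real.sqrt_le_iff.2 ⟨by positivity, ?_⟩
  have h : 0 ≤ ∑ i, dist (y i) (z i) ^ 2 := by positivity
  nlinarith [Real.sq_sqrt h, mul_nonneg (Real.sqrt_nonneg (∑ i, dist (y i) (z i) ^ 2))
    (dist_nonneg (x := t) (y := s))]

lemma measurePreserving_consPoint :
    MeasurePreserving (fun p : EuclideanSpace ℝ (Fin n) × ℝ => consPoint p.1 p.2)
      (volume.prod volume) volume := by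
  have h1 : MeasurePreserving (fun p : EuclideanSpace ℝ (Fin n) × ℝ => (p.2, WithLp.ofLp p.1))
      (volume.prod volume) (volume.prod volume) :=
    ((MeasurePreserving.id volume).prod (PiLp.volume_preserving_ofLp (Fin n))).comp
      Measure.measurePreserving_swap
  have h2 := (volume_preserving_piFinSuccAbove (fun _ : Fin (n + 1) => ℝ) 0).symm
  have h3 := PiLp.volume_preserving_toLp (Fin (n + 1))
  have heq : (fun p : EuclideanSpace ℝ (Fin n) × ℝ => consPoint p.1 p.2) =
      WithLp.toLp 2 ∘ (MeasurableEquiv.piFinSuccAbove (fun _ : Fin (n + 1) => ℝ) 0).symm ∘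
        fun p => (p.2, WithLp.ofLp p.1) := by
    funext p
    ext i
    refine Fin.cases ?_ (fun j => ?_) i <;> simp [MeasurableEquiv.piFinSuccAbove]
  rw [heq]
  exact h3.comp (h2.comp h1)

/-- Straightening the graph is a shear that translates each vertical line, so no differentiability
of `h` is needed. -/
lemma measurePreserving_graphShift (e : EuclideanSpace ℝ (Fin (n + 1)) ≃ₗᵢ[ℝ]
      EuclideanSpace ℝ (Fin (n + 1))) {h : EuclideanSpace ℝ (Fin n) → ℝ} (hh : Measurable h) :
    MeasurePreserving
      (fun p : EuclideanSpace ℝ (Fin n) × ℝ => e.symm (consPoint p.1 (h p.1 + p.2)))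
      (volume.prod volume) volume := by
  have h1 : MeasurePreserving (fun p : EuclideanSpace ℝ (Fin n) × ℝ => (p.1, h p.1 + p.2))
      (volume.prod volume) (volume.prod volume) :=
    (MeasurePreserving.id volume).skew_product (g := fun y t => h y + t) (by fun_prop)
      (ae_of_all _ fun y => map_add_left_eq_self volume (h y))
  exact e.symm.measurePreserving.comp (measurePreserving_consPoint.comp h1)

/-- Integrate the derivative of `(δ - t) * ψ t` over `[0, δ]`: the weight kills the endpoint `δ`,
leaving `δ * ψ 0 = ∫ (ψ - (δ - t) * ψ')`, and the weight is at most `δ`. -/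
lemma mul_sq_le_integral {ψ ψ' : ℝ → ℝ} {g : ℝ → ℝ} (hψ : ∀ t, HasDerivAt ψ (ψ' t) t)
    (hψ' : Continuous ψ') (hg : Continuous g) {δ : ℝ} (hδ : 0 < δ)
    (hle : ∀ t, |ψ t| ≤ g t) (hle' : ∀ t, |ψ' t| ≤ g t) :
    δ * ψ 0 ≤ (1 + δ) * ∫ t in (0 : ℝ)..δ, g t := by
  have hc : Continuous ψ := continuous_iff_continuousAt.2 fun t => (hψ t).continuousAt
  have h := intervalIntegral.integral_eq_sub_of_hasDerivAt (a := 0) (b := δ)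
    (f := fun t => (δ - t) * ψ t) (f' := fun t => -ψ t + (δ - t) * ψ' t)
    (fun t _ => by
      simpa [Pi.mul_def] using ((hasDerivAt_id t).const_sub δ).mul (hψ t)) (by apply Continuous.intervalIntegrable; fun_prop)
  simp only [sub_self, zero_mul, sub_zero, zero_sub] at h
  rw [← neg_eq_iff_eq_neg.2 h, ← intervalIntegral.integral_neg,
    ← intervalIntegral.integral_const_mul]
  refine intervalIntegral.integral_mono_on hδ.le (by apply Continuous.intervalIntegrable; fun_prop)
    (by apply Continuous.intervalIntegrable; fun_prop) fun t ht => ?_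
  have h1 := (abs_le.1 (hle t)).2
  have h2 := (abs_le.1 (hle' t)).1
  have h0 := (abs_nonneg _).trans (hle t)
  nlinarith [ht.1, ht.2, mul_le_mul_of_nonneg_left (neg_le.1 h2) (sub_nonneg.2 ht.2),
    mul_nonneg ht.1 h0]

/-- This is `mul_sq_le_integral` for `φ²` along the line, with `2 |φ| |∂φ/∂ν| ≤ φ² + |∇φ|²` bounding
the derivative. -/
lemma ofReal_mul_sq_le_lintegral_line {φ : EuclideanSpace ℝ (Fin (n + 1)) → ℝ} (hφ : ContDiff ℝ ∞ φ)
    {ν : EuclideanSpace ℝ (Fin (n + 1))} (hν : ‖ν‖ = 1) (x : EuclideanSpace ℝ (Fin (n + 1)))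
    {δ : ℝ} (hδ : 0 < δ) :
    ENNReal.ofReal δ * ENNReal.ofReal (φ x ^ 2) ≤ ENNReal.ofReal (1 + δ) *
      ∫⁻ t in Set.Ioo 0 δ, ENNReal.ofReal (φ (x + t • ν) ^ 2 + ‖gradient φ (x + t • ν)‖ ^ 2) := by
  have hφc := hφ.continuous
  have hgc := continuous_gradient_of_smooth hφ
  have hfc : Continuous (fderiv ℝ φ) := hφ.continuous_fderiv (by simp)
  have hg : Continuous fun t : ℝ => φ (x + t • ν) ^ 2 + ‖gradient φ (x + t • ν)‖ ^ 2 := by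
    fun_prop
  have hgn : ∀ z, ‖gradient φ z‖ = ‖fderiv ℝ φ z‖ := fun z => by simp [gradient]
  have key := mul_sq_le_integral (ψ := fun t => φ (x + t • ν) ^ 2)
    (ψ' := fun t => 2 * φ (x + t • ν) * fderiv ℝ φ (x + t • ν) ν) (fun t => by
      have hl : HasDerivAt (fun t : ℝ => x + t • ν) ν t := by
        simpa using ((hasDerivAt_id t).smul_const ν).const_add x
      have h1 := ((hφ.differentiable (by simp) (x + t • ν)).hasFDerivAt.comp_hasDerivAt t hl).pow 2
      simpa [Pi.pow_def, Function.comp_def] using h1)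
    (by fun_prop) hg hδ (fun t => by rw [abs_of_nonneg (sq_nonneg _)]; simp)
    (fun t => by
      have h1 : |fderiv ℝ φ (x + t • ν) ν| ≤ ‖gradient φ (x + t • ν)‖ := by
        simpa [hν, hgn] using (fderiv ℝ φ (x + t • ν)).le_opNorm ν
      rw [abs_mul, abs_mul, abs_two, ← sq_abs (φ _)]
      nlinarith [sq_nonneg (|φ (x + t • ν)| - ‖gradient φ (x + t • ν)‖),
        mul_le_mul_of_nonneg_left h1 (abs_nonneg (φ (x + t • ν)))])
  rw [← ENNReal.ofReal_mul hδ.le, ← ofReal_integral_eq_lintegral_ofReal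
    ((hg.integrableOn_Icc).mono_set Set.Ioo_subset_Icc_self) (ae_of_all _ fun t => by positivity),
    ← ENNReal.ofReal_mul (by positivity), ← integral_Ioc_eq_integral_Ioo,
    ← intervalIntegral.integral_of_le hδ.le]
  exact ENNReal.ofReal_le_ofReal (by simpa using key)

/-- The trace inequality in a neighbourhood of a boundary point. -/
lemma exists_nhds_trace_le {D : Set (EuclideanSpace ℝ (Fin (n + 1)))} (hD : IsLipschitzDomain D)
    {x₀ : EuclideanSpace ℝ (Fin (n + 1))} (hx₀ : x₀ ∈ frontier D) :
    ∃ W ∈ 𝓝 x₀, ∃ C : ℝ≥0, ∀ φ : EuclideanSpace ℝ (Fin (n + 1)) → ℝ, ContDiff ℝ ∞ φ →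
      ∫⁻ x in W, ENNReal.ofReal (φ x ^ 2) ∂(surfaceMeasure D) ≤
        C * ∫⁻ x in D, ENNReal.ofReal (φ x ^ 2 + ‖gradient φ x‖ ^ 2) := by
  obtain ⟨e, h, L, U, hL, hU, hxU, hgraph⟩ := hD.exists_graph x₀ hx₀
  -- One `δ` is for the boundary point, the other for the vertical segment starting there.
  obtain ⟨δ, hδ, hball⟩ : ∃ δ > 0, Metric.ball x₀ (δ + δ) ⊆ U := by
    obtain ⟨ε, hε, hεU⟩ := Metric.isOpen_iff.1 hU x₀ hxU
    exact ⟨ε / 2, by positivity, by simpa using hεU⟩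
  set ν : EuclideanSpace ℝ (Fin (n + 1)) := e.symm (EuclideanSpace.single 0 1) with hν
  have hν1 : ‖ν‖ = 1 := by simp [hν]
  set γ : EuclideanSpace ℝ (Fin n) → EuclideanSpace ℝ (Fin (n + 1)) :=
    fun y => e.symm (consPoint y (h y)) with hγ
  have hshift : ∀ y s, e.symm (consPoint y (h y + s)) = γ y + s • ν := fun y s => by
    simp [hγ, hν, consPoint_add]
  have hγL : LipschitzWith (1 + L) γ := LipschitzWith.of_dist_le_mul fun y z => by
    rw [hγ, e.symm.dist_map]
    refine (dist_consPoint_le _ _ _ _).trans ?_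
    have := hL.dist_le_mul y z
    push_cast
    linarith
  have hfr : ∀ x ∈ U, x ∈ frontier D → γ (WithLp.toLp 2 fun i : Fin n => e x i.succ) = x := by
    intro x hx hxf
    -- A boundary point is not above the graph, since `D` is open. Nor is it strictly below: a whole
    -- neighbourhood would then miss `D`.
    have h0 : h (WithLp.toLp 2 fun i : Fin n => e x i.succ) = e x 0 := by
      rw [hD.isOpen.frontier_eq] at hxf
      refine le_antisymm ?_ (not_lt.1 fun hlt => hxf.2 ((hgraph x hx).2 hlt))
      by_contra! hlt
      have hopen : ∀ᶠ z in 𝓝 x, e z 0 < h (WithLp.toLp 2 fun i : Fin n => e z i.succ) := by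
        have hc := hL.continuous
        exact (by fun_prop : Continuous fun z => e z 0).continuousAt.eventually_lt
          (by fun_prop : Continuous fun z => h (WithLp.toLp 2 fun i : Fin n => e z i.succ)
            ).continuousAt hlt
      obtain ⟨z, ⟨hz, hzU⟩, hzD⟩ :=
        mem_closure_iff_nhds.1 hxf.1 _ (hopen.and (hU.mem_nhds hx))
      exact lt_asymm hz ((hgraph z hzU).1 hzD)
    rw [hγ]
    simp only [h0, consPoint_self, LinearIsometryEquiv.symm_apply_apply]
  have hmeas : MeasurableSet (Metric.ball x₀ δ ∩ frontier D) :=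
    Metric.isOpen_ball.measurableSet.inter isClosed_frontier.measurableSet
  have hballU : Metric.ball x₀ δ ⊆ U := (Metric.ball_subset_ball (by linarith)).trans hball
  -- The factor `(1 + L) ^ n` comes from the graph map `γ`, and `δ⁻¹ * (1 + δ)` from the estimate on
  -- segments.
  refine ⟨Metric.ball x₀ δ, Metric.ball_mem_nhds _ hδ,
    (1 + L) ^ n * ((Real.toNNReal δ)⁻¹ * Real.toNNReal (1 + δ)), fun φ hφ => ?_⟩
  have hφc := hφ.continuous
  have hgc := continuous_gradient_of_smooth hφ
  set F : EuclideanSpace ℝ (Fin (n + 1)) → ℝ≥0∞ :=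
    fun x => ENNReal.ofReal (φ x ^ 2 + ‖gradient φ x‖ ^ 2) with hF
  have hFm : Measurable F := by
    refine (Continuous.measurable ?_).ennreal_ofReal
    fun_prop
  set B := γ ⁻¹' (Metric.ball x₀ δ ∩ frontier D) with hB
  have hBm : MeasurableSet B := hγL.continuous.measurable hmeas
  have h1 : ∫⁻ x in Metric.ball x₀ δ, ENNReal.ofReal (φ x ^ 2) ∂(surfaceMeasure D) ≤
      ((1 + L : ℝ≥0) : ℝ≥0∞) ^ n * ∫⁻ y in B, ENNReal.ofReal (φ (γ y) ^ 2) := by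
    rw [surfaceMeasure, Measure.restrict_restrict Metric.isOpen_ball.measurableSet]
    exact setLIntegral_euclideanHausdorffMeasure_le hγL
      (fun x hx => ⟨_, hfr x (hballU hx.1) hx.2⟩)
      (Continuous.measurable (by fun_prop)).ennreal_ofReal
  have h2 : ENNReal.ofReal δ * ∫⁻ y in B, ENNReal.ofReal (φ (γ y) ^ 2) ≤
      ENNReal.ofReal (1 + δ) * ∫⁻ y in B, ∫⁻ t in Set.Ioo 0 δ, F (γ y + t • ν) := by
    rw [← lintegral_const_mul' _ _ ENNReal.ofReal_ne_top,
      ← lintegral_const_mul' _ _ ENNReal.ofReal_ne_top]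
    exact lintegral_mono fun y => ofReal_mul_sq_le_lintegral_line hφ hν1 (γ y) hδ
  -- In straightened coordinates the segments fill `B × (0, δ)`, which lies in the preimage of `D`.
  have h3 : ∫⁻ y in B, ∫⁻ t in Set.Ioo 0 δ, F (γ y + t • ν) ≤ ∫⁻ x in D, F x := by
    have hmp := measurePreserving_graphShift e hL.continuous.measurable
    rw [← hmp.setLIntegral_comp_preimage hD.isOpen.measurableSet hFm]
    simp only [hshift]
    have hmc : Measurable fun p : EuclideanSpace ℝ (Fin n) × ℝ => F (γ p.1 + p.2 • ν) := by
      have := hγL.continuous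
      exact hFm.comp (Continuous.measurable (by fun_prop))
    rw [← lintegral_prod _ hmc.aemeasurable, Measure.prod_restrict]
    refine lintegral_mono_set ?_
    rintro ⟨y, t⟩ ⟨⟨hy1, hy2⟩, ht⟩
    have hxU : γ y + t • ν ∈ U := hball <| by
      rw [Metric.mem_ball] at hy1 ⊢
      calc dist (γ y + t • ν) x₀ ≤ dist (γ y + t • ν) (γ y) + dist (γ y) x₀ := dist_triangle _ _ _
        _ < δ + δ := by
          have : dist (γ y + t • ν) (γ y) = t := by
            simp [dist_eq_norm, norm_smul, hν1, abs_of_pos ht.1]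
          linarith [ht.2]
    rw [Set.mem_preimage, hgraph _ hxU, ← hshift]
    simp [ht.1]
  have hδ0 : ENNReal.ofReal δ ≠ 0 := by simpa using hδ
  have h4 : ∫⁻ y in B, ENNReal.ofReal (φ (γ y) ^ 2) ≤
      (ENNReal.ofReal δ)⁻¹ * (ENNReal.ofReal (1 + δ) * ∫⁻ x in D, F x) := by
    rw [← ENNReal.mul_le_iff_le_inv hδ0 ENNReal.ofReal_ne_top]
    exact h2.trans (by gcongr)
  calc _ ≤ _ := h1
    _ ≤ ((1 + L : ℝ≥0) : ℝ≥0∞) ^ n *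
        ((ENNReal.ofReal δ)⁻¹ * (ENNReal.ofReal (1 + δ) * ∫⁻ x in D, F x)) := by gcongr
    _ = _ := by
      rw [ENNReal.coe_mul, ENNReal.coe_mul, ENNReal.coe_inv (by simpa using hδ), ENNReal.coe_pow]
      simp only [ENNReal.ofReal, mul_assoc]

lemma exists_lintegral_trace_le {D : Set (EuclideanSpace ℝ (Fin (n + 1)))}
    (hD : IsLipschitzDomain D) :
    ∃ C : ℝ≥0, ∀ φ : EuclideanSpace ℝ (Fin (n + 1)) → ℝ, ContDiff ℝ ∞ φ →
      ∫⁻ x, ENNReal.ofReal (φ x ^ 2) ∂(surfaceMeasure D) ≤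
        C * ∫⁻ x in D, ENNReal.ofReal (φ x ^ 2 + ‖gradient φ x‖ ^ 2) := by
  have hc : IsCompact (frontier D) := Metric.isCompact_of_isClosed_isBounded isClosed_frontier
    (hD.isBounded.closure.subset frontier_subset_closure)
  obtain ⟨C, hC⟩ := hc.induction_on
    (p := fun s => ∃ C : ℝ≥0, ∀ φ : EuclideanSpace ℝ (Fin (n + 1)) → ℝ, ContDiff ℝ ∞ φ →
      ∫⁻ x in s, ENNReal.ofReal (φ x ^ 2) ∂(surfaceMeasure D) ≤
        C * ∫⁻ x in D, ENNReal.ofReal (φ x ^ 2 + ‖gradient φ x‖ ^ 2))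
    ⟨0, by simp⟩
    (fun s t hst ⟨C, hC⟩ => ⟨C, fun φ hφ => (lintegral_mono_set hst).trans (hC φ hφ)⟩)
    (fun s t ⟨C, hC⟩ ⟨C', hC'⟩ => ⟨C + C', fun φ hφ => (lintegral_union_le _ _ _).trans <| by
      rw [ENNReal.coe_add, add_mul]
      exact add_le_add (hC φ hφ) (hC' φ hφ)⟩)
    (fun x hx => by
      obtain ⟨W, hW, h⟩ := exists_nhds_trace_le hD hx
      exact ⟨W, mem_nhdsWithin_of_mem_nhds hW, h⟩)
  refine ⟨C, fun φ hφ => ?_⟩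
  have h := hC φ hφ
  rwa [surfaceMeasure, Measure.restrict_restrict isClosed_frontier.measurableSet,
    Set.inter_self] at h

lemma exists_eLpNorm_trace_le {D : Set (EuclideanSpace ℝ (Fin (n + 1)))}
    (hD : IsLipschitzDomain D) :
    ∃ C : ℝ≥0, ∀ φ : EuclideanSpace ℝ (Fin (n + 1)) → ℝ, ContDiff ℝ ∞ φ →
      eLpNorm φ 2 (surfaceMeasure D) ≤
        C * (eLpNorm φ 2 (volume.restrict D) + eLpNorm (gradient φ) 2 (volume.restrict D)) := by
  obtain ⟨C, hC⟩ := exists_lintegral_trace_le hD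
  refine ⟨NNReal.sqrt C, fun φ hφ => ?_⟩
  have hsq : ∀ {F : Type} [NormedAddCommGroup F] (μ : Measure (EuclideanSpace ℝ (Fin (n + 1))))
      (f : EuclideanSpace ℝ (Fin (n + 1)) → F),
      eLpNorm f 2 μ ^ 2 = ∫⁻ x, ENNReal.ofReal (‖f x‖ ^ 2) ∂μ := fun {F} _ μ f => by
    have h := eLpNorm_nnreal_pow_eq_lintegral (f := f) (μ := μ) (p := 2) (by norm_num)
    norm_num at h
    rw [h]
    refine lintegral_congr fun x => ?_
    rw [← ofReal_norm, ENNReal.ofReal_pow (norm_nonneg _)]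
  -- After squaring, the integral estimate applies, and `a² + b² ≤ (a + b)²` closes the gap.
  rw [← ENNReal.pow_le_pow_left_iff two_ne_zero, mul_pow, ← ENNReal.coe_pow, NNReal.sq_sqrt]
  have h := hC φ hφ
  have hm : Measurable fun x => ENNReal.ofReal (φ x ^ 2) := by
    have := hφ.continuous
    exact (Continuous.measurable (by fun_prop)).ennreal_ofReal
  simp only [fun x => ENNReal.ofReal_add (sq_nonneg (φ x)) (sq_nonneg ‖gradient φ x‖)] at h
  rw [lintegral_add_left hm, ← hsq] at h
  simp only [← Real.norm_eq_abs, ← sq_abs (φ _)] at h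
  rw [← hsq, ← hsq] at h
  refine h.trans ?_
  gcongr
  rw [add_sq, add_right_comm]
  exact le_self_add

end TraceInequality

/-! ### The trace operator -/

section TraceOperator

variable {n : ℕ} {D Γ₁ : Set (EuclideanSpace ℝ (Fin (n + 1)))}

/-- The smooth inequality passes to the limit along any sequence witnessing `HasTrace`. The factor 2
arises because the function and its gradient each have norm at most `‖u‖`. -/
lemma exists_norm_trace_le (hD : IsLipschitzDomain D) :
    ∃ C : ℝ≥0, ∀ (u : H1 D) (g : Lp ℝ 2 (surfaceMeasure D)), HasTrace u g → ‖g‖ ≤ C * ‖u‖ := by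
  obtain ⟨C, hC⟩ := exists_eLpNorm_trace_le hD
  refine ⟨C * 2, fun u g ⟨φ, hφ, h1, h2, h3⟩ => ?_⟩
  have hlim := (h3.add (ENNReal.Tendsto.const_mul (a := (C : ℝ≥0∞))
    ((h1.add_const (eLpNorm u.1.fst 2 (volume.restrict D))).add
      (h2.add_const (eLpNorm u.1.snd 2 (volume.restrict D)))) (Or.inr ENNReal.coe_ne_top)))
  have hle : eLpNorm g 2 (surfaceMeasure D) ≤ C * (eLpNorm u.1.fst 2 (volume.restrict D) +
      eLpNorm u.1.snd 2 (volume.restrict D)) := by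
    simp only [zero_add] at hlim
    refine ge_of_tendsto' hlim fun k => ?_
    have hφm : ∀ μ : Measure (EuclideanSpace ℝ (Fin (n + 1))), AEStronglyMeasurable (φ k) μ :=
      fun μ => (hφ k).continuous.aestronglyMeasurable
    have hgm := (continuous_gradient_of_smooth (hφ k)).aestronglyMeasurable
      (μ := volume.restrict D)
    have e1 : eLpNorm g 2 (surfaceMeasure D) ≤
        eLpNorm (fun x => φ k x - g x) 2 (surfaceMeasure D) + eLpNorm (φ k) 2 (surfaceMeasure D) := by
      have := eLpNorm_sub_le (hφm _) ((hφm _).sub (Lp.aestronglyMeasurable g)) (p := 2)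
        (by norm_num)
      rw [sub_sub_cancel] at this
      exact this.trans (add_comm _ _).le
    have e2 : eLpNorm (φ k) 2 (volume.restrict D) ≤
        eLpNorm (fun x => φ k x - u.1.fst x) 2 (volume.restrict D) +
          eLpNorm u.1.fst 2 (volume.restrict D) := by
      have := eLpNorm_add_le ((hφm _).sub (Lp.aestronglyMeasurable u.1.fst))
        (Lp.aestronglyMeasurable u.1.fst) (p := 2) (by norm_num)
      rwa [sub_add_cancel] at this
    have e3 : eLpNorm (gradient (φ k)) 2 (volume.restrict D) ≤
        eLpNorm (fun x => gradient (φ k) x - u.1.snd x) 2 (volume.restrict D) +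
          eLpNorm u.1.snd 2 (volume.restrict D) := by
      have := eLpNorm_add_le (hgm.sub (Lp.aestronglyMeasurable u.1.snd))
        (Lp.aestronglyMeasurable u.1.snd) (p := 2) (by norm_num)
      rwa [sub_add_cancel] at this
    exact e1.trans (by gcongr; exact (hC _ (hφ k)).trans (by gcongr))
  have hle' : ‖g‖ ≤ C * (‖u.1.fst‖ + ‖u.1.snd‖) := by
    rw [Lp.norm_def, Lp.norm_def, Lp.norm_def, ← ENNReal.toReal_add (Lp.eLpNorm_ne_top _)
      (Lp.eLpNorm_ne_top _), ← ENNReal.coe_toReal, ← ENNReal.toReal_mul]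
    exact ENNReal.toReal_mono (ENNReal.mul_ne_top ENNReal.coe_ne_top
      (ENNReal.add_ne_top.2 ⟨Lp.eLpNorm_ne_top _, Lp.eLpNorm_ne_top _⟩)) hle
  have hf : ‖u.1.fst‖ ≤ ‖u‖ := WithLp.norm_fst_le _ u.1
  have hs : ‖u.1.snd‖ ≤ ‖u‖ := WithLp.norm_snd_le _ u.1
  push_cast
  nlinarith [mul_le_mul_of_nonneg_left (add_le_add hf hs) C.2]

lemma HasTrace.unique (hD : IsLipschitzDomain D) {u : H1 D} {g h : Lp ℝ 2 (surfaceMeasure D)}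
    (hg : HasTrace u g) (hh : HasTrace u h) : g = h := by
  obtain ⟨C, hC⟩ := exists_norm_trace_le hD
  -- The difference `g - h` is a trace of `u - u = 0`.
  have h0 := hC _ _ (hg.add (hh.smul (-1)))
  rw [neg_one_smul, neg_one_smul, add_neg_cancel, norm_zero, mul_zero, ← sub_eq_add_neg] at h0
  exact sub_eq_zero.1 (norm_le_zero_iff.1 h0)

/-- The trace operator from `V` to `L²(∂D)`. -/
def traceCLM (Γ₁ : Set (EuclideanSpace ℝ (Fin (n + 1)))) (hD : IsLipschitzDomain D) :
    V D Γ₁ →L[ℝ] Lp ℝ 2 (surfaceMeasure D) :=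
  LinearMap.mkContinuousOfExistsBound
    { toFun := boundaryTrace
      -- The chosen trace of a sum and the sum of the chosen traces are both traces of `u + v`.
      map_add' := fun u v => (hasTrace_boundaryTrace (u + v)).unique hD
        ((hasTrace_boundaryTrace u).add (hasTrace_boundaryTrace v))
      map_smul' := fun c u => (hasTrace_boundaryTrace (c • u)).unique hD
        ((hasTrace_boundaryTrace u).smul c) }
    (by
      obtain ⟨C, hC⟩ := exists_norm_trace_le hD
      exact ⟨C, fun u => hC _ _ (hasTrace_boundaryTrace u)⟩)

lemma traceCLM_apply (hD : IsLipschitzDomain D) (u : V D Γ₁) :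
    traceCLM Γ₁ hD u = boundaryTrace u := rfl

/-- The embedding of `V` into `L²(D)`. -/
def interiorCLM (D Γ₁ : Set (EuclideanSpace ℝ (Fin (n + 1)))) :
    V D Γ₁ →L[ℝ] Lp ℝ 2 (volume.restrict D) :=
  WithLp.fstL 2 ℝ _ _ ∘L (H1 D).subtypeL ∘L (zeroTraceSubmodule D Γ₁).subtypeL

lemma interiorCLM_apply (u : V D Γ₁) : ⇑(interiorCLM D Γ₁ u) = interiorFun u := rfl

end TraceOperator

/-! ### Superposition operators in `L²` -/

section Superposition

variable {α : Type*} [MeasurableSpace α] {μ : Measure α} {Z : Set ℝ} {p : α → ℝ → ℝ}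

/-- The Carathéodory argument: for a simple function, finitely many sections `p(·, r)` are glued
along measurable sets; continuity of `p(x, ·)` passes to the limit. -/
lemma IsPenaltyFunction.aestronglyMeasurable_comp (hp : IsPenaltyFunction μ Z p) {f : α → ℝ}
    (hf : AEStronglyMeasurable f μ) : AEStronglyMeasurable (fun x => p x (f x)) μ := by
  obtain ⟨L, -, hL⟩ := hp.lipschitz
  obtain ⟨g, hg, hfg⟩ := hf
  have hpg : AEMeasurable (fun x => p x (g x)) μ := by
    refine aemeasurable_of_tendsto_metrizable_ae' (f := fun k x => p x (hg.approx k x))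
      (fun k => ?_) ?_
    · have hsum : (fun x => p x (hg.approx k x)) = fun x => ∑ r ∈ (hg.approx k).range,
          ((hg.approx k) ⁻¹' {r}).indicator (fun x => p x r) x := by
        funext x
        rw [Finset.sum_eq_single (hg.approx k x)]
        · simp
        · intro r _ hr
          exact Set.indicator_of_notMem (fun h => hr (by simpa using h.symm)) _
        · intro h
          exact absurd (SimpleFunc.mem_range_self _ _) h
      rw [hsum]
      exact Finset.aemeasurable_fun_sum _ fun r _ =>
        (hp.measurable r).indicator ((hg.approx k).measurableSet_preimage _)
    · filter_upwards [hL] with x hx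
      have hlip : LipschitzWith (Real.toNNReal L) (p x) := LipschitzWith.of_dist_le_mul fun r s => by
        refine (hx r s).trans ?_
        rw [Real.dist_eq]
        exact mul_le_mul_of_nonneg_right (Real.le_coe_toNNReal L) (abs_nonneg _)
      exact (hlip.continuous.tendsto _).comp (hg.tendsto_approx x)
  refine (hpg.congr ?_).aestronglyMeasurable
  filter_upwards [hfg] with x hx
  rw [hx]

lemma IsPenaltyFunction.memLp_comp (hp : IsPenaltyFunction μ Z p) (h0 : (0 : ℝ) ∈ Z) {f : α → ℝ}
    (hf : MemLp f 2 μ) : MemLp (fun x => p x (f x)) 2 μ := by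
  obtain ⟨L, -, hL⟩ := hp.lipschitz
  refine hf.of_le_mul (c := L) (hp.aestronglyMeasurable_comp hf.1) ?_
  filter_upwards [hL, hp.eq_zero_iff] with x hx hz
  have h := hx (f x) 0
  rwa [(hz 0).2 h0, sub_zero, sub_zero] at h

/-- The superposition operator `f ↦ p(·, f)` in `L²`. -/
def superposition (hp : IsPenaltyFunction μ Z p) (h0 : (0 : ℝ) ∈ Z) (f : Lp ℝ 2 μ) : Lp ℝ 2 μ :=
  (hp.memLp_comp h0 (Lp.memLp f)).toLp _

lemma coeFn_superposition (hp : IsPenaltyFunction μ Z p) (h0 : (0 : ℝ) ∈ Z) (f : Lp ℝ 2 μ) :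
    superposition hp h0 f =ᵐ[μ] fun x => p x (f x) := MemLp.coeFn_toLp _

lemma exists_lipschitzWith_superposition (hp : IsPenaltyFunction μ Z p) (h0 : (0 : ℝ) ∈ Z) :
    ∃ K : ℝ≥0, LipschitzWith K (superposition hp h0) := by
  obtain ⟨L, hL0, hL⟩ := hp.lipschitz
  refine ⟨L.toNNReal, LipschitzWith.of_dist_le_mul fun f g => ?_⟩
  rw [dist_eq_norm, dist_eq_norm, Real.coe_toNNReal _ hL0.le]
  refine Lp.norm_le_mul_norm_of_ae_le_mul ?_
  filter_upwards [hL, Lp.coeFn_sub f g, Lp.coeFn_sub (superposition hp h0 f)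
    (superposition hp h0 g), coeFn_superposition hp h0 f, coeFn_superposition hp h0 g]
    with x hx h1 h2 h3 h4
  rw [h1, h2, Pi.sub_apply, Pi.sub_apply, h3, h4]
  exact hx _ _

end Superposition

/-! ### Consequences of norm continuity -/

section Operators

variable {X : Type*} [NormedAddCommGroup X] [NormedSpace ℝ X] {A : X → StrongDual ℝ X}

lemma isBoundedOp_of_lipschitz {K : ℝ≥0} (hA : LipschitzWith K A) : IsBoundedOp A :=
  fun _ hS => hA.isBounded_image hS

lemma isDemicontinuousOp_of_continuous (hA : Continuous A) : IsDemicontinuousOp A :=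
  fun _ u₀ hu ξ => (ξ.continuous.tendsto _).comp ((hA.tendsto u₀).comp hu)

end Operators

/-- The Riesz map is isometric, so composing `f` with the adjoint of `T` costs only a factor `‖T‖`.
-/
lemma lipschitzWith_innerSL_comp {X H : Type*} [NormedAddCommGroup X] [NormedSpace ℝ X]
    [NormedAddCommGroup H] [InnerProductSpace ℝ H] {K : ℝ≥0} {f : X → H} (hf : LipschitzWith K f)
    (T : X →L[ℝ] H) : LipschitzWith (K * ‖T‖₊) fun u => (innerSL ℝ (f u)).comp T :=
  LipschitzWith.of_dist_le_mul fun u v => by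
    rw [dist_eq_norm, ← ContinuousLinearMap.sub_comp, ← map_sub]
    refine (ContinuousLinearMap.opNorm_comp_le _ _).trans ?_
    rw [innerSL_apply_norm, ← dist_eq_norm, NNReal.coe_mul, coe_nnnorm, mul_right_comm]
    exact mul_le_mul_of_nonneg_right (hf.dist_le_mul u v) (norm_nonneg _)

/-! ### Pairings of superpositions with test functions -/

section PenaltyIntegrals

variable {α : Type*} [MeasurableSpace α] {μ : Measure α} {Z : Set ℝ} {p : α → ℝ → ℝ}

lemma inner_superposition (hp : IsPenaltyFunction μ Z p) (h0 : (0 : ℝ) ∈ Z) {f g : Lp ℝ 2 μ}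
    {f' g' : α → ℝ} (hf : f =ᵐ[μ] f') (hg : g =ᵐ[μ] g') :
    inner ℝ (superposition hp h0 f) g = ∫ x, p x (f' x) * g' x ∂μ := by
  rw [L2.inner_def]
  refine integral_congr_ae ?_
  filter_upwards [coeFn_superposition hp h0 f, hf, hg] with x h1 h2 h3
  rw [h1, h2, h3]
  exact mul_comm _ _

lemma IsPenaltyFunction.integrable_mul (hp : IsPenaltyFunction μ Z p) (h0 : (0 : ℝ) ∈ Z)
    {f g : α → ℝ} (hf : MemLp f 2 μ) (hg : MemLp g 2 μ) :
    Integrable (fun x => p x (f x) * g x) μ :=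
  (hp.memLp_comp h0 hf).integrable_mul hg

end PenaltyIntegrals

/-! ### The penalty operator, its monotonicity and its signs -/

section PenaltyOperator

variable {n : ℕ} {D Γ₁ Γ₂ : Set (EuclideanSpace ℝ (Fin (n + 1)))}
  {b : EuclideanSpace ℝ (Fin (n + 1)) → ℝ} {p₀ p₂ : EuclideanSpace ℝ (Fin (n + 1)) → ℝ → ℝ}

lemma memLp_interiorFun (u : V D Γ₁) : MemLp (interiorFun u) 2 (volume.restrict D) := Lp.memLp _

lemma memLp_boundaryTrace (Γ₂ : Set (EuclideanSpace ℝ (Fin (n + 1)))) (u : V D Γ₁) :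
    MemLp (boundaryTrace u) 2 ((surfaceMeasure D).restrict Γ₂) := (Lp.memLp _).restrict _

/-- The trace operator from `V` to `L²(Γ₂)`. -/
def partTraceCLM (Γ₁ Γ₂ : Set (EuclideanSpace ℝ (Fin (n + 1)))) (hD : IsLipschitzDomain D) :
    V D Γ₁ →L[ℝ] Lp ℝ 2 ((surfaceMeasure D).restrict Γ₂) :=
  LpToLpRestrictCLM _ ℝ ℝ (surfaceMeasure D) 2 Γ₂ ∘L traceCLM Γ₁ hD

lemma coeFn_partTraceCLM (hD : IsLipschitzDomain D) (u : V D Γ₁) :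
    partTraceCLM Γ₁ Γ₂ hD u =ᵐ[(surfaceMeasure D).restrict Γ₂] boundaryTrace u :=
  LpToLpRestrictCLM_coeFn ℝ Γ₂ _

/-- The penalty operator `G : V → V*`. -/
def penaltyOperator (hD : IsLipschitzDomain D) (hb : MemLp b 2 ((surfaceMeasure D).restrict Γ₂))
    (hp₀ : IsPenaltyFunction (volume.restrict D) (Set.Ici 0) p₀)
    (hp₂ : IsPenaltyFunction ((surfaceMeasure D).restrict Γ₂) {0} p₂) (u : V D Γ₁) :
    StrongDual ℝ (V D Γ₁) :=
  (innerSL ℝ (superposition hp₀ (by simp) (interiorCLM D Γ₁ u))).comp (interiorCLM D Γ₁) +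
    (innerSL ℝ (superposition hp₂ (by simp) (partTraceCLM Γ₁ Γ₂ hD u - hb.toLp b))).comp
      (partTraceCLM Γ₁ Γ₂ hD)

lemma penaltyOperator_apply (hD : IsLipschitzDomain D)
    (hb : MemLp b 2 ((surfaceMeasure D).restrict Γ₂))
    (hp₀ : IsPenaltyFunction (volume.restrict D) (Set.Ici 0) p₀)
    (hp₂ : IsPenaltyFunction ((surfaceMeasure D).restrict Γ₂) {0} p₂) (u v : V D Γ₁) :
    penaltyOperator hD hb hp₀ hp₂ u v =
      (∫ x in D, p₀ x (interiorFun u x) * interiorFun v x) +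
        ∫ x in Γ₂, p₂ x (boundaryTrace u x - b x) * boundaryTrace v x ∂(surfaceMeasure D) := by
  have hsub : ⇑(partTraceCLM Γ₁ Γ₂ hD u - hb.toLp b) =ᵐ[(surfaceMeasure D).restrict Γ₂]
      fun x => boundaryTrace u x - b x := by
    filter_upwards [Lp.coeFn_sub (partTraceCLM Γ₁ Γ₂ hD u) (hb.toLp b), hb.coeFn_toLp,
      coeFn_partTraceCLM (Γ₂ := Γ₂) hD u] with x h1 h2 h3
    rw [h1, Pi.sub_apply, h2, h3]
  change inner ℝ (superposition hp₀ _ (interiorCLM D Γ₁ u)) (interiorCLM D Γ₁ v) +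
    inner ℝ (superposition hp₂ _ (partTraceCLM Γ₁ Γ₂ hD u - hb.toLp b))
      (partTraceCLM Γ₁ Γ₂ hD v) = _
  rw [inner_superposition hp₂ _ hsub (coeFn_partTraceCLM hD v),
    inner_superposition hp₀ _ (EventuallyEq.refl _ _) (EventuallyEq.refl _ _)]
  simp only [interiorCLM_apply]

lemma exists_lipschitzWith_penaltyOperator (hD : IsLipschitzDomain D)
    (hb : MemLp b 2 ((surfaceMeasure D).restrict Γ₂))
    (hp₀ : IsPenaltyFunction (volume.restrict D) (Set.Ici 0) p₀)
    (hp₂ : IsPenaltyFunction ((surfaceMeasure D).restrict Γ₂) {0} p₂) :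
    ∃ K : ℝ≥0, LipschitzWith K (penaltyOperator (Γ₁ := Γ₁) hD hb hp₀ hp₂) := by
  obtain ⟨K₀, hK₀⟩ := exists_lipschitzWith_superposition hp₀ (by simp)
  obtain ⟨K₂, hK₂⟩ := exists_lipschitzWith_superposition hp₂ (by simp)
  exact ⟨_, (lipschitzWith_innerSL_comp (hK₀.comp (interiorCLM D Γ₁).lipschitz) _).add
    (lipschitzWith_innerSL_comp (hK₂.comp
      ((partTraceCLM Γ₁ Γ₂ hD).lipschitz.sub (LipschitzWith.const (hb.toLp b)))) _)⟩

lemma interiorFun_sub (u v : V D Γ₁) :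
    interiorFun (u - v) =ᵐ[volume.restrict D] fun x => interiorFun u x - interiorFun v x := by
  simp only [← interiorCLM_apply, map_sub]
  exact Lp.coeFn_sub _ _

lemma boundaryTrace_sub (hD : IsLipschitzDomain D) (u v : V D Γ₁) :
    boundaryTrace (u - v) =ᵐ[(surfaceMeasure D).restrict Γ₂]
      fun x => boundaryTrace u x - boundaryTrace v x := by
  simp only [← traceCLM_apply hD, map_sub]
  exact ae_restrict_of_ae (Lp.coeFn_sub _ _)

lemma penaltyOperator_apply_sub (hD : IsLipschitzDomain D)
    (hb : MemLp b 2 ((surfaceMeasure D).restrict Γ₂))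
    (hp₀ : IsPenaltyFunction (volume.restrict D) (Set.Ici 0) p₀)
    (hp₂ : IsPenaltyFunction ((surfaceMeasure D).restrict Γ₂) {0} p₂) (u v w : V D Γ₁) :
    penaltyOperator hD hb hp₀ hp₂ u (v - w) =
      (∫ x in D, p₀ x (interiorFun u x) * (interiorFun v x - interiorFun w x)) +
        ∫ x in Γ₂, p₂ x (boundaryTrace u x - b x) * (boundaryTrace v x - boundaryTrace w x)
          ∂(surfaceMeasure D) := by
  rw [penaltyOperator_apply]
  congr 1
  · refine integral_congr_ae ?_
    filter_upwards [interiorFun_sub v w] with x hx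
    rw [hx]
  · refine integral_congr_ae ?_
    filter_upwards [boundaryTrace_sub (Γ₂ := Γ₂) hD v w] with x hx
    rw [hx]

lemma isMonotoneOp_penaltyOperator (hD : IsLipschitzDomain D)
    (hb : MemLp b 2 ((surfaceMeasure D).restrict Γ₂))
    (hp₀ : IsPenaltyFunction (volume.restrict D) (Set.Ici 0) p₀)
    (hp₂ : IsPenaltyFunction ((surfaceMeasure D).restrict Γ₂) {0} p₂) :
    IsMonotoneOp (penaltyOperator (Γ₁ := Γ₁) hD hb hp₀ hp₂) := by
  intro u v
  have hi := fun w : V D Γ₁ => hp₀.integrable_mul (by simp) (memLp_interiorFun w)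
    ((memLp_interiorFun u).sub (memLp_interiorFun v))
  have ht := fun w : V D Γ₁ => hp₂.integrable_mul (by simp) ((memLp_boundaryTrace Γ₂ w).sub hb)
    ((memLp_boundaryTrace Γ₂ u).sub (memLp_boundaryTrace Γ₂ v))
  simp only [Pi.sub_apply] at hi ht
  rw [sub_apply, penaltyOperator_apply_sub, penaltyOperator_apply_sub,
    add_sub_add_comm, ← integral_sub (hi u) (hi v), ← integral_sub (ht u) (ht v)]
  refine add_nonneg (integral_nonneg_of_ae ?_) (integral_nonneg_of_ae ?_)
  · filter_upwards [hp₀.monotone] with x hx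
    have h := hx (interiorFun u x) (interiorFun v x)
    rwa [sub_mul] at h
  · filter_upwards [hp₂.monotone] with x hx
    have h := hx (boundaryTrace u x - b x) (boundaryTrace v x - b x)
    -- The shift by `b` cancels in the difference of the arguments.
    rwa [sub_sub_sub_cancel_right, sub_mul] at h

/-- Where `u ≥ 0` the penalty vanishes. Where `u < 0`, comparison with the zero at `0` makes it
nonpositive, while `v - u > 0`. -/
lemma interior_penalty_nonpos (hp₀ : IsPenaltyFunction (volume.restrict D) (Set.Ici 0) p₀)
    (u : V D Γ₁) {v : V D Γ₁} (hv : NonnegInside v) :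
    ∀ᵐ x ∂volume.restrict D, p₀ x (interiorFun u x) * (interiorFun v x - interiorFun u x) ≤ 0 := by
  filter_upwards [hp₀.monotone, hp₀.eq_zero_iff, hv] with x hm hz hx
  rcases le_or_gt 0 (interiorFun u x) with h | h
  · rw [(hz _).2 h, zero_mul]
  · have h1 := hm (interiorFun u x) 0
    rw [(hz 0).2 (by simp), sub_zero, sub_zero] at h1
    have h2 : p₀ x (interiorFun u x) ≤ 0 := nonpos_of_mul_nonneg_left h1 h
    exact mul_nonpos_of_nonpos_of_nonneg h2 (by linarith)

/-- Since `v = b`, the second factor is `-(u - b)`, and monotonicity against the zero at `0` gives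
the sign. -/
lemma boundary_penalty_nonpos
    (hp₂ : IsPenaltyFunction ((surfaceMeasure D).restrict Γ₂) {0} p₂)
    (u : V D Γ₁) {v : V D Γ₁} (hv : EqOnBoundaryPart Γ₂ b v) :
    ∀ᵐ x ∂(surfaceMeasure D).restrict Γ₂,
      p₂ x (boundaryTrace u x - b x) * (boundaryTrace v x - boundaryTrace u x) ≤ 0 := by
  filter_upwards [hp₂.monotone, hp₂.eq_zero_iff, hv] with x hm hz hx
  have h1 := hm (boundaryTrace u x - b x) 0
  rw [(hz 0).2 (by simp), sub_zero, sub_zero] at h1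
  rw [hx]
  linarith

end PenaltyOperator

end

theorem mainTheorem12 (n : ℕ)
    (D Γ₁ Γ₂ Γ₃ : Set (EuclideanSpace ℝ (Fin (n + 1))))
    (hD : IsLipschitzDomain D) (hΓ : IsBoundaryPartition D Γ₁ Γ₂ Γ₃)
    (b : EuclideanSpace ℝ (Fin (n + 1)) → ℝ)
    (hb : MemLp b 2 ((surfaceMeasure D).restrict Γ₂))
    (hub : ∃ ub : V D Γ₁, NonnegInside ub ∧ EqOnBoundaryPart Γ₂ b ub)
    (p₀ p₂ : EuclideanSpace ℝ (Fin (n + 1)) → ℝ → ℝ)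
    (hp₀ : IsPenaltyFunction (volume.restrict D) (Set.Ici 0) p₀)
    (hp₂ : IsPenaltyFunction ((surfaceMeasure D).restrict Γ₂) {0} p₂) :
    (∀ u v : V D Γ₁,
      Integrable (fun x => p₀ x (interiorFun u x) * interiorFun v x) (volume.restrict D) ∧
      Integrable (fun x => p₂ x (boundaryTrace u x - b x) * boundaryTrace v x)
        ((surfaceMeasure D).restrict Γ₂)) ∧
    ∃ G : V D Γ₁ → StrongDual ℝ (V D Γ₁),
      (∀ u v : V D Γ₁,
        G u v = (∫ x in D, p₀ x (interiorFun u x) * interiorFun v x) +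
          ∫ x in Γ₂, p₂ x (boundaryTrace u x - b x) * boundaryTrace v x ∂(surfaceMeasure D)) ∧
      RelaxedSetCondition (obstacleSet D Γ₁ Γ₂ b) (Set.univ : Set (V D Γ₁)) ∧
      PenaltyOperatorCondition (obstacleSet D Γ₁ Γ₂ b) (Set.univ : Set (V D Γ₁)) G := by
  obtain ⟨K, hK⟩ := exists_lipschitzWith_penaltyOperator (Γ₁ := Γ₁) hD hb hp₀ hp₂
  refine ⟨fun u v => ⟨hp₀.integrable_mul (by simp) (memLp_interiorFun u) (memLp_interiorFun v),
      hp₂.integrable_mul (by simp) ((memLp_boundaryTrace Γ₂ u).sub hb) (memLp_boundaryTrace Γ₂ v)⟩,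
    penaltyOperator hD hb hp₀ hp₂, penaltyOperator_apply hD hb hp₀ hp₂,
    ⟨isClosed_univ, convex_univ, Set.subset_univ _⟩,
    isBoundedOp_of_lipschitz hK, isDemicontinuousOp_of_continuous hK.continuous,
    isMonotoneOp_penaltyOperator hD hb hp₀ hp₂, fun u _ v hv => ?_, fun u _ hu => ?_⟩
  · rw [penaltyOperator_apply_sub]
    exact add_nonpos (integral_nonpos_of_ae (interior_penalty_nonpos hp₀ u hv.1))
      (integral_nonpos_of_ae (boundary_penalty_nonpos hp₂ u hv.2))
  -- Nonemptiness of `K` enters here: one test element suffices.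
  · obtain ⟨v, hv⟩ := hub
    have h := hu v hv
    have hneg₀ := interior_penalty_nonpos hp₀ u hv.1
    have hneg₂ := boundary_penalty_nonpos hp₂ u hv.2
    have hint₀ := integral_nonpos_of_ae hneg₀
    have hint₂ := integral_nonpos_of_ae hneg₂
    have hi := hp₀.integrable_mul (by simp) (memLp_interiorFun u)
      ((memLp_interiorFun v).sub (memLp_interiorFun u))
    have ht := hp₂.integrable_mul (by simp) ((memLp_boundaryTrace Γ₂ u).sub hb)
      ((memLp_boundaryTrace Γ₂ v).sub (memLp_boundaryTrace Γ₂ u))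
    simp only [Pi.sub_apply] at hi ht
    rw [penaltyOperator_apply_sub] at h
    -- Two nonpositive integrals with sum zero both vanish, hence so do their signed integrands.
    have hz₀ := (integral_eq_zero_iff_of_nonneg_ae (hneg₀.mono fun x hx => neg_nonneg.2 hx)
      hi.neg).1 (by rw [integral_neg]; linarith)
    have hz₂ := (integral_eq_zero_iff_of_nonneg_ae (hneg₂.mono fun x hx => neg_nonneg.2 hx)
      ht.neg).1 (by rw [integral_neg]; linarith)
    refine ⟨?_, ?_⟩
    · filter_upwards [hz₀, hp₀.eq_zero_iff, hv.1] with x hx hz hvx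
      -- Either the penalty vanishes and the exact zero set gives `u ≥ 0`, or `u = v ≥ 0` at this
      -- point.
      rcases mul_eq_zero.1 (neg_eq_zero.1 hx) with h0 | h0
      · exact (hz _).1 h0
      · rwa [← sub_eq_zero.1 h0]
    · filter_upwards [hz₂, hp₂.eq_zero_iff, hv.2] with x hx hz hvx
      rcases mul_eq_zero.1 (neg_eq_zero.1 hx) with h0 | h0
      · exact sub_eq_zero.1 ((hz _).1 h0)
      · rw [← sub_eq_zero.1 h0, hvx]
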